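/- Let $0\le r\le n-2$ be integers and $N=2^n$. Index rows, columns and coordinates by $\{0,\dots,N-1\}$, let $\mathrm{w}(i)$ be the number of ones in the $n$-bit binary expansion of $i$, and let $G_N=\begin{bmatrix}1&0\\1&1\end{bmatrix}^{\otimes n}$ ($n$-fold Kronecker power) over $\mathbb F_2$. Let $\mathcal I=\{i : \mathrm{w}(i)\ge n-r\}$ be the rate-profile of the Reed–Muller code $\mathrm{RM}(r,n)$, and let $T\in\mathbb F_2^{N\times N}$ be any upper-triangular pre-transformation matrix, that is, $t_{i,j}=0$ for $i>j$ and $t_{i,i}=1$ for $i\in\mathcal I$. The pre-transformed polar code is $$\mathcal P(\mathcal I,T)=\{\,v\,T\,G_N : v\in\mathbb F_2^N,\ v_i=0 \text{ for all } i\notin\mathcal I\,\}.$$ Then $\mathcal P(\mathcal I,T)$ has minimum Hamming distance $d_{\min}=2^{n-r}$, and the number of its codewords of Hamming weight $d_{\min}$ is at least $$\frac{8\cdot 2^{3r}-6\cdot 2^{2r}+2^r}{3}.$$ -/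

import Mathlib

open scoped Matrix Kronecker

/-- The `n`-fold Kronecker power `[[1,0],[1,1]]^{⊗ n}` over `𝔽₂`. Rows and columns are numbered
`0, …, 2^n - 1`; `finProdFinEquiv (a, b) = b + 2 * a` is the usual numbering of the Kronecker
product with a `2 × 2` right factor. -/
def polarMatrix : (n : ℕ) → Matrix (Fin (2 ^ n)) (Fin (2 ^ n)) (ZMod 2)
  | 0 => 1
  | n + 1 =>
    let e : Fin (2 ^ n) × Fin 2 ≃ Fin (2 ^ (n + 1)) :=
      finProdFinEquiv.trans (finCongr (pow_succ 2 n).symm)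
    Matrix.reindex e e (polarMatrix n ⊗ₖ !![1, 0; 1, 1])

/-- The number of ones in the `n`-bit binary expansion of the index `i`. -/
def indexWeight {n : ℕ} (i : Fin (2 ^ n)) : ℕ :=
  (Finset.univ.filter fun l : Fin n => (i : ℕ).testBit (l : ℕ) = true).card

/-- The Reed-Muller rate-profile: the indices of weight at least `n - r`. -/
def rmProfile (r n : ℕ) : Set (Fin (2 ^ n)) :=
  {i | n - r ≤ indexWeight i}

/-- `T` is an upper-triangular pre-transformation matrix for the rate-profile `I`. The diagonal
entries are only prescribed on `I`. -/
def IsPreTransform {N : ℕ} (I : Set (Fin N)) (T : Matrix (Fin N) (Fin N) (ZMod 2)) : Prop :=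
  (∀ i j, j < i → T i j = 0) ∧ ∀ i ∈ I, T i i = 1

/-- The pre-transformed polar code with rate-profile `I` and pre-transformation `T`: all words
`v T G` with `v` vanishing outside `I`. -/
def ptpc {n : ℕ} (I : Set (Fin (2 ^ n))) (T : Matrix (Fin (2 ^ n)) (Fin (2 ^ n)) (ZMod 2)) :
    Set (Fin (2 ^ n) → ZMod 2) :=
  {c | ∃ v : Fin (2 ^ n) → ZMod 2, (∀ i, i ∉ I → v i = 0) ∧ c = (v ᵥ* T) ᵥ* polarMatrix n}

/-- The minimum Hamming distance between distinct codewords (`0` for a code with at most one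
codeword). -/
noncomputable def minDistance {N : ℕ} (C : Set (Fin N → ZMod 2)) : ℕ :=
  sInf {d | ∃ c ∈ C, ∃ c' ∈ C, c ≠ c' ∧ hammingDist c c' = d}

/-- The number of codewords of Hamming weight `w`. -/
noncomputable def numWeight {N : ℕ} (C : Set (Fin N → ZMod 2)) (w : ℕ) : ℕ :=
  {c ∈ C | hammingNorm c = w}.ncard

/-! Distance: `u * G_N` has weight at least that of the row at the leading index of `u`
(`two_pow_indexWeight_le`). A triangular `T` keeps the leading index of `v`, which lies in the
profile.

Count: the bound is `(2^(r+2)).choose 3 / 4`, the number of blocks of a Steiner quadruple system on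
`2^(r+2)` points. For `n = r + 2` the code is even, has distance at least 4 and redundancy at most
`r + 3`, so counting shows that each odd word is one flip away from a codeword. Hence each triple of
coordinates lies in the support of a codeword of weight 4, and each such support holds four triples.
For larger `n`, the upper half of the indices carries a code of the same kind with length `2^(n-1)`,
and `c ↦ (c, c)` embeds it with weights doubled. -/

/-! ### Entries of the polar matrix and binary digits of indices. -/

/-- The numbering of `{0, …, 2^(n+1) - 1}` by the quotient and the remainder modulo two. -/
def lowBitEquiv (n : ℕ) : Fin (2 ^ n) × Fin 2 ≃ Fin (2 ^ (n + 1)) :=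
  finProdFinEquiv.trans (finCongr (pow_succ 2 n).symm)

/-- The numbering of `{0, …, 2^(n+1) - 1}` by the lower and the upper half. -/
def topBitEquiv (n : ℕ) : Fin (2 ^ n) ⊕ Fin (2 ^ n) ≃ Fin (2 ^ (n + 1)) :=
  finSumFinEquiv.trans (finCongr (by rw [pow_succ, mul_two]))

lemma lowBitEquiv_val {n : ℕ} (a : Fin (2 ^ n)) (b : Fin 2) :
    (lowBitEquiv n (a, b) : ℕ) = b + 2 * a := by
  simp [lowBitEquiv, finProdFinEquiv]

lemma topBitEquiv_inl_val {n : ℕ} (a : Fin (2 ^ n)) : (topBitEquiv n (.inl a) : ℕ) = a := by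
  simp [topBitEquiv]

lemma topBitEquiv_inr_val {n : ℕ} (a : Fin (2 ^ n)) :
    (topBitEquiv n (.inr a) : ℕ) = 2 ^ n + a := by
  simp [topBitEquiv, add_comm]

lemma polarMatrix_succ_apply {n : ℕ} (a a' : Fin (2 ^ n)) (b b' : Fin 2) :
    polarMatrix (n + 1) (lowBitEquiv n (a, b)) (lowBitEquiv n (a', b')) =
      polarMatrix n a a' * (!![1, 0; 1, 1] : Matrix (Fin 2) (Fin 2) (ZMod 2)) b b' := by
  simp only [polarMatrix, lowBitEquiv, Matrix.reindex_apply, Matrix.submatrix_apply,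
    Equiv.symm_apply_apply, Matrix.kroneckerMap_apply]

lemma testBit_lowBitEquiv_zero {n : ℕ} (a : Fin (2 ^ n)) (b : Fin 2) :
    (lowBitEquiv n (a, b) : ℕ).testBit 0 = decide (b = 1) := by
  rw [lowBitEquiv_val, Nat.testBit_zero]
  fin_cases b <;> simp [Nat.add_mod]

lemma testBit_lowBitEquiv_succ {n : ℕ} (a : Fin (2 ^ n)) (b : Fin 2) (l : ℕ) :
    (lowBitEquiv n (a, b) : ℕ).testBit (l + 1) = (a : ℕ).testBit l := by
  rw [lowBitEquiv_val, Nat.testBit_succ]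
  congr 1
  omega

open Classical in
/-- The entry `(i, j)` of the polar matrix is one exactly if the ones of `j` are ones of `i`. -/
lemma polarMatrix_apply {n : ℕ} (i j : Fin (2 ^ n)) :
    polarMatrix n i j =
      if ∀ l, (j : ℕ).testBit l = true → (i : ℕ).testBit l = true then 1 else 0 := by
  induction n with
  | zero =>
    obtain rfl : i = j := Subsingleton.elim (α := Fin 1) _ _
    simp [polarMatrix]
  | succ n ih =>
    obtain ⟨⟨a, b⟩, rfl⟩ := (lowBitEquiv n).surjective i
    obtain ⟨⟨a', b'⟩, rfl⟩ := (lowBitEquiv n).surjective j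
    rw [polarMatrix_succ_apply, ih]
    have key : (∀ l, (lowBitEquiv n (a', b') : ℕ).testBit l = true →
          (lowBitEquiv n (a, b) : ℕ).testBit l = true) ↔
        (b' = 1 → b = 1) ∧ ∀ l, (a' : ℕ).testBit l = true → (a : ℕ).testBit l = true := by
      constructor
      · intro h
        refine ⟨fun hb => ?_, fun l hl => ?_⟩
        · simpa only [testBit_lowBitEquiv_zero, hb, decide_eq_true_eq, true_imp_iff] using h 0
        · simpa [testBit_lowBitEquiv_succ, hl] using h (l + 1)
      · rintro ⟨h0, h⟩ (_ | l) hl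
        · simp only [testBit_lowBitEquiv_zero, decide_eq_true_eq] at hl ⊢
          exact h0 hl
        · simp only [testBit_lowBitEquiv_succ] at hl ⊢
          exact h l hl
    rw [if_congr key rfl rfl]
    fin_cases b <;> fin_cases b' <;> simp

lemma indexWeight_lowBitEquiv {n : ℕ} (a : Fin (2 ^ n)) (b : Fin 2) :
    indexWeight (lowBitEquiv n (a, b)) = b + indexWeight a := by
  unfold indexWeight
  rw [Fin.card_filter_univ_succ']
  simp only [Fin.val_succ, Fin.val_zero, testBit_lowBitEquiv_succ,
    testBit_lowBitEquiv_zero]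
  fin_cases b <;> simp

lemma indexWeight_topBitEquiv_inr {n : ℕ} (a : Fin (2 ^ n)) :
    indexWeight (topBitEquiv n (.inr a)) = indexWeight a + 1 := by
  unfold indexWeight
  rw [Finset.card_filter, Finset.card_filter, Fin.sum_univ_castSucc]
  congr 1
  · refine Finset.sum_congr rfl fun l _ => ?_
    rw [topBitEquiv_inr_val, Fin.val_castSucc, Nat.testBit_two_pow_add_gt l.2]
  · rw [topBitEquiv_inr_val, Fin.val_last, Nat.testBit_two_pow_add_eq,
      Nat.testBit_lt_two_pow a.2]
    simp

/-- A row index in the upper half has its top bit set, so the top bit of the column imposes no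
condition: the row is a row of the smaller matrix written twice. -/
lemma polarMatrix_topBitEquiv {n : ℕ} (i j : Fin (2 ^ n)) :
    polarMatrix (n + 1) (topBitEquiv n (.inr i)) (topBitEquiv n (.inl j)) = polarMatrix n i j ∧
    polarMatrix (n + 1) (topBitEquiv n (.inr i)) (topBitEquiv n (.inr j)) =
      polarMatrix n i j := by
  classical
  have hbit (k : Fin (2 ^ n)) (l : ℕ) : (topBitEquiv n (.inr k) : ℕ).testBit l =
      (decide (l = n) || (k : ℕ).testBit l) := by
    have := Nat.two_pow_add_eq_or_of_lt k.2 1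
    rw [mul_one] at this
    rw [topBitEquiv_inr_val, this, Nat.testBit_or,
      Nat.testBit_two_pow]
    simp [eq_comm]
  have hn : (j : ℕ).testBit n = false := Nat.testBit_lt_two_pow j.2
  simp only [polarMatrix_apply, hbit, topBitEquiv_inl_val, Bool.or_eq_true, decide_eq_true_eq]
  refine ⟨if_congr (forall_congr' fun l => ?_) rfl rfl,
    if_congr (forall_congr' fun l => ?_) rfl rfl⟩ <;>
  · by_cases hl : l = n
    · subst hl; simp [hn]
    · simp [hl]

/-! ### Weights and parity by recursion on the lowest bit. -/

lemma sum_lowBitEquiv {n : ℕ} {M : Type*} [AddCommMonoid M] (f : Fin (2 ^ (n + 1)) → M) :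
    ∑ x, f x = ∑ a, (f (lowBitEquiv n (a, 0)) + f (lowBitEquiv n (a, 1))) := by
  rw [← (lowBitEquiv n).sum_comp, Fintype.sum_prod_type]
  simp [Fin.sum_univ_two]

lemma sum_topBitEquiv {n : ℕ} {M : Type*} [AddCommMonoid M] (f : Fin (2 ^ (n + 1)) → M) :
    ∑ x, f x = ∑ a, f (topBitEquiv n (.inl a)) + ∑ a, f (topBitEquiv n (.inr a)) := by
  rw [← (topBitEquiv n).sum_comp, Fintype.sum_sum_type]

lemma vecMul_polarMatrix_zero {n : ℕ} (u : Fin (2 ^ (n + 1)) → ZMod 2) (a : Fin (2 ^ n)) :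
    (u ᵥ* polarMatrix (n + 1)) (lowBitEquiv n (a, 0)) =
      ((fun a => u (lowBitEquiv n (a, 0)) + u (lowBitEquiv n (a, 1))) ᵥ* polarMatrix n) a := by
  simp only [Matrix.vecMul, dotProduct]
  rw [sum_lowBitEquiv]
  simp [polarMatrix_succ_apply, add_mul]

lemma vecMul_polarMatrix_one {n : ℕ} (u : Fin (2 ^ (n + 1)) → ZMod 2) (a : Fin (2 ^ n)) :
    (u ᵥ* polarMatrix (n + 1)) (lowBitEquiv n (a, 1)) =
      ((fun a => u (lowBitEquiv n (a, 1))) ᵥ* polarMatrix n) a := by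
  simp only [Matrix.vecMul, dotProduct]
  rw [sum_lowBitEquiv]
  simp [polarMatrix_succ_apply]

lemma hammingNorm_eq_sum {ι : Type*} [Fintype ι] (c : ι → ZMod 2) :
    hammingNorm c = ∑ i, if c i ≠ 0 then 1 else 0 := by
  simp [hammingNorm, Finset.card_filter]

lemma hammingNorm_vecMul_polarMatrix_succ {n : ℕ} (u : Fin (2 ^ (n + 1)) → ZMod 2) :
    hammingNorm (u ᵥ* polarMatrix (n + 1)) =
      hammingNorm ((fun a => u (lowBitEquiv n (a, 0)) + u (lowBitEquiv n (a, 1)))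
        ᵥ* polarMatrix n) +
      hammingNorm ((fun a => u (lowBitEquiv n (a, 1))) ᵥ* polarMatrix n) := by
  simp only [hammingNorm_eq_sum]
  rw [sum_lowBitEquiv, Finset.sum_add_distrib]
  simp only [vecMul_polarMatrix_zero, vecMul_polarMatrix_one]

/-- The weight of a word is at least the weight of the row of the polar matrix at its
leading index. -/
lemma two_pow_indexWeight_le {n : ℕ} (u : Fin (2 ^ n) → ZMod 2) (i : Fin (2 ^ n))
    (hi : u i ≠ 0) (hlt : ∀ j < i, u j = 0) :
    2 ^ indexWeight i ≤ hammingNorm (u ᵥ* polarMatrix n) := by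
  induction n with
  | zero =>
    have h : indexWeight i = 0 := by simp [indexWeight]
    rw [h]
    refine Nat.one_le_iff_ne_zero.2 (hammingNorm_ne_zero_iff.2 fun hu => ?_)
    rw [polarMatrix, Matrix.vecMul_one] at hu
    exact hi (congrFun hu i)
  | succ n ih =>
    obtain ⟨⟨a, b⟩, rfl⟩ := (lowBitEquiv n).surjective i
    have hlow (a' : Fin (2 ^ n)) (ha : a' < a) (b' : Fin 2) : u (lowBitEquiv n (a', b')) = 0 := by
      apply hlt
      rw [Fin.lt_def, lowBitEquiv_val, lowBitEquiv_val]
      have := b'.2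
      rw [Fin.lt_def] at ha
      omega
    rw [hammingNorm_vecMul_polarMatrix_succ, indexWeight_lowBitEquiv]
    -- For an even leading index, one of the two halves has leading index `a`, depending on whether
    -- `u` vanishes at the odd neighbour; for an odd one, both halves do.
    fin_cases b
    · by_cases h1 : u (lowBitEquiv n (a, 1)) = 0
      · refine le_add_right ?_
        simp only [zero_add]
        apply ih
        · simpa [h1] using hi
        · intro j hj
          simp [hlow j hj]
      · refine le_add_left ?_
        simp only [zero_add]
        exact ih _ _ h1 fun j hj => hlow j hj 1
    · have h0 : u (lowBitEquiv n (a, 0)) = 0 := by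
        apply hlt
        rw [Fin.lt_def, lowBitEquiv_val, lowBitEquiv_val]
        simp
      change 2 ^ (1 + indexWeight a) ≤ _
      rw [pow_add, pow_one, two_mul]
      refine add_le_add (ih _ _ ?_ ?_) (ih _ _ ?_ ?_)
      · simpa [h0] using hi
      · intro j hj
        simp [hlow j hj]
      · simpa using hi
      · exact fun j hj => hlow j hj 1

/-- Only the row of index zero has odd weight. -/
lemma sum_vecMul_polarMatrix {n : ℕ} (u : Fin (2 ^ n) → ZMod 2) :
    ∑ j, (u ᵥ* polarMatrix n) j = u ⟨0, by positivity⟩ := by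
  induction n with
  | zero =>
    rw [polarMatrix, Matrix.vecMul_one]
    exact Fin.sum_univ_one u
  | succ n ih =>
    rw [sum_lowBitEquiv, Finset.sum_add_distrib]
    simp only [vecMul_polarMatrix_zero, vecMul_polarMatrix_one, ih]
    rw [add_assoc, CharTwo.add_self_eq_zero, add_zero]
    congr 1

/-! ### Minimum distance. -/

section Code

variable {n r : ℕ} {T : Matrix (Fin (2 ^ n)) (Fin (2 ^ n)) (ZMod 2)}

lemma zero_mem_ptpc (I : Set (Fin (2 ^ n))) : 0 ∈ ptpc I T := ⟨0, by simp, by simp⟩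

lemma sub_mem_ptpc {I : Set (Fin (2 ^ n))} {c c' : Fin (2 ^ n) → ZMod 2} (hc : c ∈ ptpc I T)
    (hc' : c' ∈ ptpc I T) : c - c' ∈ ptpc I T := by
  obtain ⟨v, hv, rfl⟩ := hc
  obtain ⟨v', hv', rfl⟩ := hc'
  exact ⟨v - v', fun i hi => by simp [hv i hi, hv' i hi], by simp [Matrix.sub_vecMul]⟩

lemma le_hammingNorm_vecMul (hT : IsPreTransform (rmProfile r n) T) {v : Fin (2 ^ n) → ZMod 2}
    (hv : ∀ i, i ∉ rmProfile r n → v i = 0) (hv0 : v ≠ 0) :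
    2 ^ (n - r) ≤ hammingNorm ((v ᵥ* T) ᵥ* polarMatrix n) := by
  obtain ⟨i, hi, hmin⟩ : ∃ i, v i ≠ 0 ∧ ∀ j < i, v j = 0 := by
    obtain ⟨i, hi⟩ := WellFounded.has_min (wellFounded_lt (α := Fin (2 ^ n))) {i | v i ≠ 0}
      (Function.ne_iff.1 hv0)
    exact ⟨i, hi.1, fun j hj => by_contra fun h => hi.2 j h hj⟩
  have hiI : i ∈ rmProfile r n := by_contra fun h => hi (hv i h)
  refine (Nat.pow_le_pow_right two_pos hiI).trans (two_pow_indexWeight_le _ i ?_ ?_)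
  · have : (v ᵥ* T) i = v i := by
      simp only [Matrix.vecMul, dotProduct]
      rw [Finset.sum_eq_single i, hT.2 i hiI, mul_one]
      · intro k _ hk
        rcases hk.lt_or_gt with h | h
        · rw [hmin k h, zero_mul]
        · rw [hT.1 k i h, mul_zero]
      · simp
    rwa [this]
  · intro j hj
    simp only [Matrix.vecMul, dotProduct]
    refine Finset.sum_eq_zero fun k _ => ?_
    rcases lt_or_ge k i with h | h
    · rw [hmin k h, zero_mul]
    · rw [hT.1 k j (hj.trans_le h), mul_zero]

lemma le_hammingNorm_of_mem_ptpc (hT : IsPreTransform (rmProfile r n) T)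
    {c : Fin (2 ^ n) → ZMod 2} (hc : c ∈ ptpc (rmProfile r n) T) (hc0 : c ≠ 0) :
    2 ^ (n - r) ≤ hammingNorm c := by
  obtain ⟨v, hv, rfl⟩ := hc
  refine le_hammingNorm_vecMul hT hv ?_
  rintro rfl
  simp at hc0

/-- The count is assumed positive so that the lower bound is attained, by a codeword of that weight
and zero. -/
lemma minDistance_ptpc (hT : IsPreTransform (rmProfile r n) T)
    (h : 0 < numWeight (ptpc (rmProfile r n) T) (2 ^ (n - r))) :
    minDistance (ptpc (rmProfile r n) T) = 2 ^ (n - r) := by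
  obtain ⟨c, hc, hcw⟩ := Set.nonempty_of_ncard_ne_zero h.ne'
  refine IsLeast.csInf_eq ⟨⟨c, hc, 0, zero_mem_ptpc _, ?_, ?_⟩, ?_⟩
  · rintro rfl
    simp only [hammingNorm_zero] at hcw
    exact (pow_pos two_pos _).ne hcw
  · rw [hammingDist_zero_right, hcw]
  · rintro d ⟨c, hc, c', hc', hne, rfl⟩
    rw [hammingDist_comm, hammingDist_eq_hammingNorm, neg_add_eq_sub]
    exact le_hammingNorm_of_mem_ptpc hT (sub_mem_ptpc hc hc') (sub_ne_zero.2 hne)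

end Code

/-! ### Doubling: from length `2^n` to `2^(n+1)`. -/

/-- The lower right block of a square matrix of order `2^(n+1)`. -/
def upperBlock {n : ℕ} (T : Matrix (Fin (2 ^ (n + 1))) (Fin (2 ^ (n + 1))) (ZMod 2)) :
    Matrix (Fin (2 ^ n)) (Fin (2 ^ n)) (ZMod 2) :=
  T.submatrix (fun i => topBitEquiv n (.inr i)) (fun i => topBitEquiv n (.inr i))

/-- The weight and the threshold both grow by one; `r ≤ n` keeps the subtraction from truncating. -/
lemma mem_rmProfile_topBitEquiv_inr {n r : ℕ} (hr : r ≤ n) (i : Fin (2 ^ n)) :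
    topBitEquiv n (.inr i) ∈ rmProfile r (n + 1) ↔ i ∈ rmProfile r n := by
  simp only [rmProfile, Set.mem_ofPred_eq, indexWeight_topBitEquiv_inr]
  omega

lemma IsPreTransform.upperBlock {n r : ℕ} (hr : r ≤ n)
    {T : Matrix (Fin (2 ^ (n + 1))) (Fin (2 ^ (n + 1))) (ZMod 2)}
    (hT : IsPreTransform (rmProfile r (n + 1)) T) :
    IsPreTransform (rmProfile r n) (upperBlock T) := by
  refine ⟨fun i j hij => hT.1 _ _ ?_, fun i hi => hT.2 _ ?_⟩
  · rw [Fin.lt_def, topBitEquiv_inr_val, topBitEquiv_inr_val]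
    simpa using hij
  · rwa [mem_rmProfile_topBitEquiv_inr hr]

/-- The word repeated twice. -/
def doubleWord {n : ℕ} (c : Fin (2 ^ n) → ZMod 2) : Fin (2 ^ (n + 1)) → ZMod 2 :=
  fun x => Sum.elim c c ((topBitEquiv n).symm x)

lemma hammingNorm_doubleWord {n : ℕ} (c : Fin (2 ^ n) → ZMod 2) :
    hammingNorm (doubleWord c) = 2 * hammingNorm c := by
  simp only [hammingNorm_eq_sum]
  rw [sum_topBitEquiv, two_mul]
  simp [doubleWord]

lemma doubleWord_injective {n : ℕ} : Function.Injective (doubleWord (n := n)) := by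
  intro c c' h
  ext j
  simpa [doubleWord] using congrFun h (topBitEquiv n (.inr j))

lemma doubleWord_mem_ptpc {n r : ℕ} (hr : r ≤ n)
    {T : Matrix (Fin (2 ^ (n + 1))) (Fin (2 ^ (n + 1))) (ZMod 2)}
    (hT : IsPreTransform (rmProfile r (n + 1)) T) {c : Fin (2 ^ n) → ZMod 2}
    (hc : c ∈ ptpc (rmProfile r n) (upperBlock T)) :
    doubleWord c ∈ ptpc (rmProfile r (n + 1)) T := by
  obtain ⟨v, hv, rfl⟩ := hc
  -- Extending `v` by zero on the lower half is harmless: triangularity keeps `w ᵥ* T` zero there.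
  set w : Fin (2 ^ (n + 1)) → ZMod 2 := fun x => Sum.elim 0 v ((topBitEquiv n).symm x) with hw
  have hinl (a : Fin (2 ^ n)) : (w ᵥ* T) (topBitEquiv n (.inl a)) = 0 := by
    simp only [Matrix.vecMul, dotProduct]
    rw [sum_topBitEquiv]
    simp only [hw, Equiv.symm_apply_apply, Sum.elim_inl, Sum.elim_inr, Pi.zero_apply, zero_mul,
      Finset.sum_const_zero, zero_add]
    refine Finset.sum_eq_zero fun k _ => ?_
    rw [hT.1, mul_zero]
    rw [Fin.lt_def, topBitEquiv_inl_val, topBitEquiv_inr_val]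
    have := a.2
    omega
  have hinr (a : Fin (2 ^ n)) :
      (w ᵥ* T) (topBitEquiv n (.inr a)) = (v ᵥ* upperBlock T) a := by
    simp only [Matrix.vecMul, dotProduct]
    rw [sum_topBitEquiv]
    simp [hw, upperBlock]
  refine ⟨w, fun x hx => ?_, ?_⟩
  · obtain ⟨a | a, rfl⟩ := (topBitEquiv n).surjective x
    · simp [hw]
    · rw [mem_rmProfile_topBitEquiv_inr hr] at hx
      simp [hw, hv a hx]
  · ext x
    simp only [Matrix.vecMul_eq_sum (w ᵥ* T), Finset.sum_apply, Pi.smul_apply, smul_eq_mul]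
    rw [sum_topBitEquiv]
    simp only [hinl, hinr, zero_mul, Finset.sum_const_zero, zero_add]
    obtain ⟨a | a, rfl⟩ := (topBitEquiv n).surjective x
    · simp [doubleWord, Matrix.vecMul_eq_sum (v ᵥ* upperBlock T), polarMatrix_topBitEquiv]
    · simp [doubleWord, Matrix.vecMul_eq_sum (v ᵥ* upperBlock T), polarMatrix_topBitEquiv]

lemma numWeight_upperBlock_le {n r : ℕ} (hr : r ≤ n)
    {T : Matrix (Fin (2 ^ (n + 1))) (Fin (2 ^ (n + 1))) (ZMod 2)}
    (hT : IsPreTransform (rmProfile r (n + 1)) T) :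
    numWeight (ptpc (rmProfile r n) (upperBlock T)) (2 ^ (n - r)) ≤
      numWeight (ptpc (rmProfile r (n + 1)) T) (2 ^ (n + 1 - r)) := by
  refine Set.ncard_le_ncard_of_injOn doubleWord ?_ doubleWord_injective.injOn (Set.toFinite _)
  rintro c ⟨hc, hcw⟩
  refine ⟨doubleWord_mem_ptpc hr hT hc, ?_⟩
  rw [hammingNorm_doubleWord, hcw, Nat.succ_sub hr, pow_succ, mul_comm]

/-! ### The base case `n = r + 2`. -/

/-- At most `r + 3` indices of `r + 2` bits have weight less than two. -/
lemma card_compl_rmProfile_le (r : ℕ) : (rmProfile r (r + 2))ᶜ.ncard ≤ r + 3 := by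
  have hsub : (rmProfile r (r + 2))ᶜ ⊆ insert (⟨0, by positivity⟩ : Fin (2 ^ (r + 2)))
      (Set.range fun l : Fin (r + 2) =>
        (⟨2 ^ (l : ℕ), Nat.pow_lt_pow_right one_lt_two l.2⟩ : Fin (2 ^ (r + 2)))) := by
    intro i hi
    simp only [rmProfile, Set.mem_compl_iff, Set.mem_ofPred_eq, not_le] at hi
    have hi : (Finset.univ.filter fun l : Fin (r + 2) =>
        (i : ℕ).testBit (l : ℕ) = true).card ≤ 1 := by
      unfold indexWeight at hi
      omega
    rw [Finset.card_le_one] at hi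
    have hbound (l : ℕ) (hl : (i : ℕ).testBit l = true) : l < r + 2 := by
      by_contra! h
      rw [Nat.testBit_lt_two_pow (i.2.trans_le (Nat.pow_le_pow_right two_pos h))] at hl
      simp at hl
    rcases Nat.eq_zero_or_pos (i : ℕ) with h0 | h0
    · left
      exact Fin.ext h0
    · right
      obtain ⟨l, hl⟩ := Nat.exists_testBit_of_ne_zero h0.ne'
      refine ⟨⟨l, hbound l hl⟩, Fin.ext (Nat.eq_of_testBit_eq fun m => ?_)⟩
      rw [Nat.testBit_two_pow]
      by_cases hm : (i : ℕ).testBit m = true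
      · have := hi ⟨l, hbound l hl⟩ (by simpa using hl) ⟨m, hbound m hm⟩ (by simpa using hm)
        simp only [Fin.mk.injEq] at this
        simp [hm, this]
      · have : l ≠ m := by
          rintro rfl
          exact hm hl
        simp [hm, this]
  refine (Set.ncard_le_ncard hsub (Set.toFinite _)).trans ((Set.ncard_insert_le _ _).trans ?_)
  have : (Set.range fun l : Fin (r + 2) =>
      (⟨2 ^ (l : ℕ), Nat.pow_lt_pow_right one_lt_two l.2⟩ : Fin (2 ^ (r + 2)))).ncard ≤ r + 2 := by
    rw [← Set.image_univ]
    refine (Set.ncard_image_le (Set.toFinite _)).trans ?_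
    simp [Set.ncard_univ]
  omega

section Hamming

variable {r : ℕ} {T : Matrix (Fin (2 ^ (r + 2))) (Fin (2 ^ (r + 2))) (ZMod 2)}

/-- Index 0 is outside the profile and `T` is triangular, so the only row of odd weight is never
used. -/
lemma sum_eq_zero_of_mem_ptpc (hT : IsPreTransform (rmProfile r (r + 2)) T)
    {c : Fin (2 ^ (r + 2)) → ZMod 2} (hc : c ∈ ptpc (rmProfile r (r + 2)) T) :
    ∑ j, c j = 0 := by
  obtain ⟨v, hv, rfl⟩ := hc
  rw [sum_vecMul_polarMatrix]
  simp only [Matrix.vecMul, dotProduct]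
  refine Finset.sum_eq_zero fun k _ => ?_
  by_cases hk : (k : ℕ) = 0
  · rw [hv, zero_mul]
    simp [rmProfile, indexWeight, hk]
  · rw [hT.1, mul_zero]
    rw [Fin.lt_def]
    exact Nat.pos_of_ne_zero hk

lemma hammingNorm_single {N : ℕ} (d : Fin N) :
    hammingNorm (Pi.single d 1 : Fin N → ZMod 2) = 1 := by
  rw [hammingNorm_eq_sum]
  simp [Pi.single_apply]

/-- Every word of odd weight is at distance one from a codeword. -/
lemma exists_sub_single_mem_ptpc (hT : IsPreTransform (rmProfile r (r + 2)) T)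
    {x : Fin (2 ^ (r + 2)) → ZMod 2} (hx : ∑ j, x j = 1) :
    ∃ d, x - Pi.single d 1 ∈ ptpc (rmProfile r (r + 2)) T := by
  classical
  set I := rmProfile r (r + 2)
  let o : Fin (2 ^ (r + 2)) := ⟨0, by positivity⟩
  let ext : (I → ZMod 2) → Fin (2 ^ (r + 2)) → ZMod 2 :=
    fun v i => if h : i ∈ I then v ⟨i, h⟩ else 0
  have hext (v) (i) (hi : i ∉ I) : ext v i = 0 := dif_neg hi
  let word : (I → ZMod 2) → Fin (2 ^ (r + 2)) → ZMod 2 :=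
    fun v => (ext v ᵥ* T) ᵥ* polarMatrix (r + 2)
  have hword (v) : word v ∈ ptpc I T := ⟨ext v, hext v, rfl⟩
  -- The flip at `o` by `ε` adjusts the parity, so that the count runs over the whole space; odd
  -- words correspond to `ε = 0`.
  let Φ : (I → ZMod 2) × Fin (2 ^ (r + 2)) × ZMod 2 → Fin (2 ^ (r + 2)) → ZMod 2 :=
    fun p => word p.1 + Pi.single p.2.1 1 + Pi.single o p.2.2
  have hsum (p) : ∑ j, Φ p j = 1 + p.2.2 := by
    simp only [Φ, Pi.add_apply, Finset.sum_add_distrib, Finset.sum_pi_single', Finset.mem_univ,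
      if_true, sum_eq_zero_of_mem_ptpc hT (hword p.1), zero_add]
  have hinj : Function.Injective Φ := by
    rintro ⟨v, d, ε⟩ ⟨v', d', ε'⟩ h
    obtain rfl : ε = ε' := by
      have := congrArg (fun c => ∑ j, c j) h
      simpa only [hsum, add_right_inj] using this
    have h : word v + Pi.single d 1 = word v' + Pi.single d' 1 := add_right_cancel h
    have hmem := sub_mem_ptpc (hword v) (hword v')
    have hdiff : word v - word v' = Pi.single d' 1 - Pi.single d 1 := by
      rw [sub_eq_sub_iff_add_eq_add, h]
      exact add_comm _ _
    -- Two flips are too few to join distinct codewords, whose distance is at least 4.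
    have hnorm : hammingNorm (word v - word v') ≤ 2 := by
      rw [hdiff, ← neg_add_eq_sub, ← hammingDist_eq_hammingNorm]
      refine (hammingDist_triangle _ 0 _).trans ?_
      rw [hammingDist_zero_right, hammingDist_zero_left, hammingNorm_single, hammingNorm_single]
    have h0 : word v - word v' = 0 := by
      by_contra hne
      have := (le_hammingNorm_of_mem_ptpc hT hmem hne).trans hnorm
      norm_num [show r + 2 - r = 2 by omega] at this
    obtain rfl : d = d' := by
      by_contra hne
      have := congrFun (hdiff.symm.trans h0) d
      simp [hne] at this
    have hv : ext v - ext v' = 0 := by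
      by_contra hne
      have := le_hammingNorm_vecMul hT (v := ext v - ext v')
        (fun i hi => by simp [hext _ i hi]) hne
      rw [Matrix.sub_vecMul, Matrix.sub_vecMul] at this
      change _ ≤ hammingNorm (word v - word v') at this
      rw [h0, hammingNorm_zero] at this
      exact (pow_pos two_pos _).not_ge this
    have : v = v' := by
      ext i
      have := congrFun (sub_eq_zero.1 hv) i
      simpa [ext] using this
    rw [this]
  have hcard : Nat.card (Fin (2 ^ (r + 2)) → ZMod 2) ≤
      Nat.card ((I → ZMod 2) × Fin (2 ^ (r + 2)) × ZMod 2) := by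
    have h1 := card_compl_rmProfile_le r
    have h2 := Set.ncard_add_ncard_compl I
    rw [Nat.card_fin] at h2
    simp only [Nat.card_prod, Nat.card_fun, Nat.card_zmod, Nat.card_fin, Nat.card_coe_set_eq]
    rw [← pow_succ, ← pow_add]
    refine Nat.pow_le_pow_right two_pos ?_
    change Iᶜ.ncard ≤ _ at h1
    omega
  obtain ⟨⟨v, d, ε⟩, rfl⟩ := (hinj.bijective_of_nat_card_le hcard).2 x
  rw [hsum] at hx
  obtain rfl : ε = 0 := by simpa using hx
  exact ⟨d, by simpa [Φ] using hword v⟩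

/-- The support of a word. -/
def wordSupport {N : ℕ} (c : Fin N → ZMod 2) : Finset (Fin N) :=
  Finset.univ.filter fun i => c i ≠ 0

/-- Every three coordinates lie in the support of a codeword of weight four. -/
lemma exists_mem_ptpc_subset_wordSupport (hT : IsPreTransform (rmProfile r (r + 2)) T)
    {S : Finset (Fin (2 ^ (r + 2)))} (hS : S.card = 3) :
    ∃ c ∈ ptpc (rmProfile r (r + 2)) T, hammingNorm c = 4 ∧ S ⊆ wordSupport c := by
  classical
  -- The indicator of `S` is odd. Flipping coordinate `d` yields a codeword that is nonzero, hence
  -- of weight at least 4, inside `insert d S`: its support is all of that set.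
  let x : Fin (2 ^ (r + 2)) → ZMod 2 := fun i => if i ∈ S then 1 else 0
  have hx : ∑ j, x j = 1 := by
    simp only [x, Finset.sum_ite_mem, Finset.univ_inter, Finset.sum_const, hS]
    decide
  obtain ⟨d, hd⟩ := exists_sub_single_mem_ptpc hT hx
  refine ⟨_, hd, ?_⟩
  have hsub : wordSupport (x - Pi.single d 1) ⊆ insert d S := by
    intro i hi
    by_contra hne
    simp only [Finset.mem_insert, not_or] at hne
    simp [wordSupport, x, hne] at hi
  have hinsert : (insert d S).card ≤ 4 := by simpa [hS] using Finset.card_insert_le d S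
  have hne : x - Pi.single d 1 ≠ 0 := by
    intro h
    have hSd : S ⊆ {d} := by
      intro i hi
      by_contra hid
      have := congrFun h i
      simp only [Finset.mem_singleton] at hid
      simp [x, hi, hid] at this
    have := Finset.card_le_card hSd
    simp [hS] at this
  have hge : 4 ≤ (wordSupport (x - Pi.single d 1)).card := by
    have := le_hammingNorm_of_mem_ptpc hT hd hne
    rwa [Nat.add_sub_cancel_left] at this
  refine ⟨le_antisymm ((Finset.card_le_card hsub).trans hinsert) hge, ?_⟩
  rw [Finset.eq_of_subset_of_card_le hsub (hinsert.trans hge)]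
  exact Finset.subset_insert _ _

lemma choose_three_le_four_mul_numWeight (hT : IsPreTransform (rmProfile r (r + 2)) T) :
    (2 ^ (r + 2)).choose 3 ≤ 4 * numWeight (ptpc (rmProfile r (r + 2)) T) 4 := by
  classical
  set W : Set (Fin (2 ^ (r + 2)) → ZMod 2) :=
    {c ∈ ptpc (rmProfile r (r + 2)) T | hammingNorm c = 4}
  have hW : numWeight (ptpc (rmProfile r (r + 2)) T) 4 = W.toFinset.card :=
    Set.ncard_eq_toFinset_card' W
  have hsub : (Finset.univ : Finset (Fin (2 ^ (r + 2)))).powersetCard 3 ⊆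
      W.toFinset.biUnion fun c => (wordSupport c).powersetCard 3 := by
    intro S hS
    obtain ⟨c, hc, hc4, hSc⟩ :=
      exists_mem_ptpc_subset_wordSupport hT (Finset.mem_powersetCard.1 hS).2
    rw [Finset.mem_biUnion]
    exact ⟨c, Set.mem_toFinset.2 ⟨hc, hc4⟩,
      Finset.mem_powersetCard.2 ⟨hSc, (Finset.mem_powersetCard.1 hS).2⟩⟩
  have hle := (Finset.card_le_card hsub).trans
    (Finset.card_biUnion_le_card_mul _ _ 4 fun c hc => ?_)
  · rwa [Finset.card_powersetCard, Finset.card_univ, Fintype.card_fin, mul_comm, ← hW] at hle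
  · have : (wordSupport c).card = 4 := (Set.mem_toFinset.1 hc).2
    rw [Finset.card_powersetCard, this]
    decide

end Hamming

/-! ### Induction on `n` and the closed form. -/

lemma le_numWeight_ptpc (n r : ℕ) (hr : r + 2 ≤ n)
    (T : Matrix (Fin (2 ^ n)) (Fin (2 ^ n)) (ZMod 2)) (hT : IsPreTransform (rmProfile r n) T) :
    (2 ^ (r + 2)).choose 3 ≤ 4 * numWeight (ptpc (rmProfile r n) T) (2 ^ (n - r)) := by
  induction n, hr using Nat.le_induction with
  | base =>
    simpa [show r + 2 - r = 2 by omega] using choose_three_le_four_mul_numWeight hT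
  | succ n hn ih =>
    have hrn : r ≤ n := by omega
    exact (ih _ (hT.upperBlock hrn)).trans
      (Nat.mul_le_mul_left 4 (numWeight_upperBlock_le hrn hT))

theorem mainTheorem1 (n r : ℕ) (hr : r + 2 ≤ n)
    (T : Matrix (Fin (2 ^ n)) (Fin (2 ^ n)) (ZMod 2)) (hT : IsPreTransform (rmProfile r n) T) :
    minDistance (ptpc (rmProfile r n) T) = 2 ^ (n - r) ∧
      (8 * 2 ^ (3 * r) - 6 * 2 ^ (2 * r) + 2 ^ r : ℚ) / 3 ≤
        (numWeight (ptpc (rmProfile r n) T) (2 ^ (n - r)) : ℚ) := by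
  have h := le_numWeight_ptpc n r hr T hT
  have hN : 3 ≤ 2 ^ (r + 2) := by
    have := Nat.pow_le_pow_right two_pos (show 2 ≤ r + 2 by omega)
    omega
  refine ⟨minDistance_ptpc hT ?_, ?_⟩
  · have := Nat.choose_pos hN
    omega
  · have hc : ((2 ^ (r + 2)).choose 3 : ℚ) =
        (2 ^ (r + 2)) * (2 ^ (r + 2) - 1) * (2 ^ (r + 2) - 2) / 6 := by
      rw [Nat.cast_choose_eq_descPochhammer_div]
      simp [descPochhammer_succ_eval, Nat.factorial]
    have hq : ((2 ^ (r + 2)).choose 3 : ℚ) ≤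
        4 * (numWeight (ptpc (rmProfile r n) T) (2 ^ (n - r)) : ℚ) := by exact_mod_cast h
    rw [hc] at hq
    rw [mul_comm 3 r, mul_comm 2 r, pow_mul, pow_mul]
    rw [pow_add] at hq
    -- With `R = 2^r`, the bound is `4R(4R-1)(4R-2)/24 = (8R³-6R²+R)/3`.
    generalize (2 : ℚ) ^ r = R at hq ⊢
    linarith
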